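/- Let $N$ be a finite non-empty set of players, $n_\nu\in\mathbb N$ for $\nu\in N$, and $\mathbb{R}^n=\prod_{\nu\in N}\mathbb{R}^{n_\nu}$, with its usual topology. Let $\|\cdot\|$ be any norm on $\mathbb{R}^n$. For each $\nu\in N$ let $K_\nu\subset\mathbb{R}^{n_\nu}$ be non-empty, convex and compact, and put $K=\prod_{\nu\in N}K_\nu$. For each $\nu\in N$ let $X_\nu:K\rightrightarrows\mathbb{R}^{n_\nu}$ be a continuous (that is, upper and lower semicontinuous) set-valued map with non-empty, convex and compact values, and let $\theta_\nu:\mathbb{R}^n\to\mathbb{R}$ be a function such that 1. $\theta_\nu$ is pseudo-continuous: whenever $\theta_\nu(x)<\theta_\nu(y)$, there are a neighbourhood $V$ of $x$ with $\theta_\nu(x')<\theta_\nu(y)$ for all $x'\in V$, and a neighbourhood $W$ of $y$ with $\theta_\nu(x)<\theta_\nu(y')$ for all $y'\in W$; 2. for every choice of the other players' strategies $x^{-\nu}\in\prod_{\mu\ne\nu}\mathbb{R}^{n_\mu}$, the function $\theta_\nu(\cdot,x^{-\nu})$ is quasi-convex on $\mathbb{R}^{n_\nu}$. Then the generalized Nash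 equilibrium problem has a projected solution: there are $\hat x\in K$ and $\hat y\in\prod_{\nu\in N}X_\nu(\hat x)$ such that $$\|\hat y-\hat x\|\le\|\hat y-x\|\quad\text{for all }x\in K,$$ and $\hat y$ is a Nash equilibrium of the game with loss functions $\theta_\nu$ and strategy sets $X_\nu(\hat x)$, that is, $$\theta_\nu(\hat y)\le\theta_\nu(z^\nu,\hat y^{-\nu})\quad\text{for all }\nu\in N\text{ and all }z^\nu\in X_\nu(\hat x).$$ -/

import Mathlib

/-- The joint strategy space `ℝⁿ = ∏ ν, ℝ^{n ν}` of the players `ν : N`, with the product topology.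
Its built-in (sup) norm plays no role: the norm of the problem is an explicit argument below. -/
abbrev JointSpace {N : Type*} (n : N → ℕ) : Type _ := (ν : N) → Fin (n ν) → ℝ

/-- The set `P_A(z) = {w ∈ A | ‖z - w‖ ≤ ‖z - x‖ for all x ∈ A}` for the norm `nrm`. -/
def projectionSet {E : Type*} [AddCommGroup E] [Module ℝ E] (nrm : Seminorm ℝ E)
    (A : Set E) (z : E) : Set E :=
  {w | w ∈ A ∧ ∀ x ∈ A, nrm (z - w) ≤ nrm (z - x)}

/-- Upper pseudo-continuity: if `f x < f y` then `f x' < f y` for all `x'` near `x`. -/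
def UpperPseudoContinuous {Y : Type*} [TopologicalSpace Y] (f : Y → ℝ) : Prop :=
  ∀ x y, f x < f y → ∃ V ∈ nhds x, ∀ x' ∈ V, f x' < f y

/-- Lower pseudo-continuity: `-f` is upper pseudo-continuous. -/
def LowerPseudoContinuous {Y : Type*} [TopologicalSpace Y] (f : Y → ℝ) : Prop :=
  UpperPseudoContinuous (fun x => -f x)

/-- A function is pseudo-continuous if it is upper and lower pseudo-continuous. -/
def PseudoContinuous {Y : Type*} [TopologicalSpace Y] (f : Y → ℝ) : Prop :=
  UpperPseudoContinuous f ∧ LowerPseudoContinuous f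

/-- A set-valued map is continuous on `s` (for the relative topology of `s`) if it is upper and
lower semicontinuous there; Mathlib calls these properties upper and lower hemicontinuity. -/
def SetValuedContinuousOn {Y Z : Type*} [TopologicalSpace Y] [TopologicalSpace Z]
    (T : Y → Set Z) (s : Set Y) : Prop :=
  UpperHemicontinuousOn T s ∧ LowerHemicontinuousOn T s

/-- The set of Nash equilibria of the game with loss functions `θ ν` and strategy sets `S ν`.
The point `(z^ν, x^{-ν})` is `Function.update x ν z`. -/
def nashEquilibria {N : Type*} [DecidableEq N] {n : N → ℕ}
    (θ : N → JointSpace n → ℝ) (S : (ν : N) → Set (Fin (n ν) → ℝ)) : Set (JointSpace n) :=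
  {x | ∀ ν, x ν ∈ S ν ∧ ∀ z ∈ S ν, θ ν x ≤ θ ν (Function.update x ν z)}

/-- `x ∈ K = ∏ ν, K ν` is a projected solution of the generalized Nash game with constraint maps
`X ν : K ⇉ ℝ^{n ν}` (only the values of `X ν` on `K` matter) and loss functions `θ ν`. -/
def IsProjectedSolution {N : Type*} [DecidableEq N] {n : N → ℕ}
    (nrm : Seminorm ℝ (JointSpace n)) (K : (ν : N) → Set (Fin (n ν) → ℝ))
    (X : (ν : N) → JointSpace n → Set (Fin (n ν) → ℝ))
    (θ : N → JointSpace n → ℝ) (x : JointSpace n) : Prop :=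
  x ∈ Set.univ.pi K ∧
    ∃ y ∈ Set.univ.pi (fun ν => X ν x),
      x ∈ projectionSet nrm (Set.univ.pi K) y ∧ y ∈ nashEquilibria θ (fun ν => X ν x)

/-! Strategy sets need not lie in $K$, so the search is for a pair $(x,y)$, with $x\in K$ and $y$ in
a compact box containing all strategy sets. Send $(x,y)$ to the product of the set of points of $K$
nearest to $y$ and the sets of minimisers of $\theta_\nu(\cdot,y^{-\nu})$ over $X_\nu(x)$. A fixed
point says that $x$ is a projection of $y$ and that each $y^\nu$ is a best reply to $y^{-\nu}$,
which is the claim.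

Kakutani's theorem gives the fixed point. Values are convex by the triangle inequality and
quasi-convexity. Pseudo-continuity makes $\{\theta(x)<\theta(y)\}$ open
(`PseudoContinuous.isOpen_lt`); so minimisers exist on compact sets, and, with both semicontinuities
of $X_\nu$, the graph is closed.

Kakutani follows from Brouwer on a simplex through partitions of unity and a limit; Brouwer follows
from Scarf's lemma, a parity count on a grid. -/

/-- For linear orders on `V` indexed by `I`, given by rank functions `r i`, a finite set `R` is
dominating if every point is below all of `R` for one of the orders. -/
def IsDominating {I V α : Type*} [LE α] (r : I → V → α) (R : Finset V) : Prop :=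
  ∀ v, ∃ i, ∀ x ∈ R, r i v ≤ r i x

/-- `x` is the `k`-largest among the points that are `l`-above `m l` for all `l ≠ k`. -/
def IsTopAbove {I V α : Type*} [LinearOrder α] (r : I → V → α) (m : I → V) (k : I) (x : V) : Prop :=
  (∀ l, l ≠ k → r l (m l) < r l x) ∧
    ∀ y, (∀ l, l ≠ k → r l (m l) < r l y) → r k y ≤ r k x

/-! ### Scarf's lemma -/

section Scarf

variable {I V α : Type*} [LinearOrder α] {r : I → V → α}

theorem IsDominating.mono {R D : Finset V} (h : IsDominating r R) (hDR : D ⊆ R) :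
    IsDominating r D := fun v => (h v).imp fun _ hi x hx => hi x (hDR hx)

theorem IsTopAbove.eq (hr : ∀ i, Function.Injective (r i)) {m : I → V} {k : I} {x y : V}
    (hx : IsTopAbove r m k x) (hy : IsTopAbove r m k y) : x = y :=
  hr k (le_antisymm (hy.2 x hx.1) (hx.2 y hy.1))

theorem exists_isTopAbove [Fintype V] {m : I → V} {k : I} {y : V} (hy : ∀ l, l ≠ k → r l (m l) < r l y) :
    ∃ x, IsTopAbove r m k x := by
  classical
  obtain ⟨x, hx, hmax⟩ := (Finset.univ.filter fun y => ∀ l, l ≠ k → r l (m l) < r l y).exists_max_image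
    (r k) ⟨y, by simpa using hy⟩
  exact ⟨x, by simpa using hx, fun z hz => hmax z (by simpa using hz)⟩

/-- The order for which `d` itself is below all of `D` has `d` as its minimum on `D`. -/
theorem IsDominating.exists_eq_min (hr : ∀ i, Function.Injective (r i)) {D : Finset V} {m : I → V}
    (hm : ∀ l, m l ∈ D ∧ ∀ d ∈ D, r l (m l) ≤ r l d) (hD : IsDominating r D) {d : V} (hd : d ∈ D) :
    ∃ l, m l = d := by
  obtain ⟨l, hl⟩ := hD d
  exact ⟨l, hr l (le_antisymm ((hm l).2 d hd) (hl _ (hm l).1))⟩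

/-- The minima of a dominating set with one element less than there are orders coincide for
exactly two of the orders, and the dominating sets with one element more are obtained by adding a
top element for one of these two orders. -/
theorem IsDominating.exists_pair [Fintype I] [DecidableEq V] (hr : ∀ i, Function.Injective (r i)) {D : Finset V} {m : I → V}
    (hm : ∀ l, m l ∈ D ∧ ∀ d ∈ D, r l (m l) ≤ r l d) (hD : IsDominating r D)
    (hcard : D.card + 1 = Fintype.card I) :
    ∃ i j, i ≠ j ∧ m i = m j ∧
      (∀ x, (x ∉ D ∧ IsDominating r (insert x D)) ↔ IsTopAbove r m i x ∨ IsTopAbove r m j x) ∧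
      ∀ x, ¬ (IsTopAbove r m i x ∧ IsTopAbove r m j x) := by
  classical
  obtain ⟨i, -, j, -, hij, hmij⟩ := Finset.exists_ne_map_eq_of_card_lt_of_maps_to
    (s := (Finset.univ : Finset I)) (t := D) (f := m) (by rw [Finset.card_univ]; omega)
    (fun l _ => (hm l).1)
  refine ⟨i, j, hij, hmij, fun x => ⟨?_, ?_⟩, ?_⟩
  · rintro ⟨hxD, hx⟩
    obtain ⟨k, hk⟩ := hx x
    -- Domination of `d` by `insert x D` makes `d` the minimum for an order in which `x` lies above
    -- it. Order `k` is not of this kind, so counting shows that all others are and that `m` is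
    -- injective on them; hence `k` is one of the colliding orders.
    have hsub : D ⊆ (Finset.univ.filter fun l => r l (m l) < r l x).image m := by
      intro d hd
      obtain ⟨l, hl⟩ := hx d
      have hdl : m l = d := hr l (le_antisymm ((hm l).2 d hd)
        (hl _ (Finset.mem_insert_of_mem (hm l).1)))
      refine Finset.mem_image.2 ⟨l, ?_, hdl⟩
      rw [Finset.mem_filter, hdl]
      refine ⟨Finset.mem_univ _, lt_of_le_of_ne (hl x (Finset.mem_insert_self _ _)) fun h => ?_⟩
      exact hxD (hr l h ▸ hd)
    have hSk : (Finset.univ.filter fun l => r l (m l) < r l x) ⊆ Finset.univ.erase k := by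
      intro l hl
      rw [Finset.mem_filter] at hl
      refine Finset.mem_erase.2 ⟨?_, Finset.mem_univ _⟩
      rintro rfl
      exact absurd (hk _ (Finset.mem_insert_of_mem (hm l).1)) (not_le.2 hl.2)
    have hcardk : (Finset.univ.erase k : Finset I).card = D.card := by
      rw [Finset.card_erase_of_mem (Finset.mem_univ _), Finset.card_univ]; omega
    have hSeq : (Finset.univ.filter fun l => r l (m l) < r l x) = Finset.univ.erase k :=
      Finset.eq_of_subset_of_card_le hSk
        (hcardk.le.trans ((Finset.card_le_card hsub).trans Finset.card_image_le))
    have hinj : Set.InjOn m (Finset.univ.erase k : Finset I) := by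
      rw [← Finset.card_image_iff]
      refine le_antisymm Finset.card_image_le ?_
      rw [hcardk, ← hSeq]
      exact Finset.card_le_card hsub
    have htop : IsTopAbove r m k x := by
      refine ⟨fun l hl => ?_, fun y hy => ?_⟩
      · have : l ∈ Finset.univ.filter fun l => r l (m l) < r l x := by
          rw [hSeq]; exact Finset.mem_erase.2 ⟨hl, Finset.mem_univ _⟩
        exact (Finset.mem_filter.1 this).2
      · obtain ⟨l, hl⟩ := hx y
        by_cases hlk : l = k
        · subst hlk; exact hl x (Finset.mem_insert_self _ _)
        · exact absurd (hl _ (Finset.mem_insert_of_mem (hm l).1)) (not_le.2 (hy l hlk))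
    have hk' : k = i ∨ k = j := by
      by_contra! h
      exact hij (hinj (by simpa using h.1.symm) (by simpa using h.2.symm) hmij)
    rcases hk' with rfl | rfl
    exacts [Or.inl htop, Or.inr htop]
  · have key : ∀ k k', k ≠ k' → m k = m k' → IsTopAbove r m k x →
        x ∉ D ∧ IsDominating r (insert x D) := by
      intro k k' hkk' hmk hx
      constructor
      · intro hxD
        obtain ⟨l, rfl⟩ := hD.exists_eq_min hr hm hxD
        by_cases hlk : l = k
        · subst hlk
          exact (hx.1 k' hkk'.symm).ne (by rw [hmk])
        · exact (hx.1 l hlk).ne rfl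
      · intro v
        -- If `v` exceeds every `m l` with `l ≠ k`, only order `k` can dominate it, and `x` is
        -- `k`-maximal among such points. Otherwise an order `l ≠ k` with `v` below `m l` still
        -- works after `x` is added.
        by_cases hv : ∀ l, l ≠ k → r l (m l) < r l v
        · obtain ⟨l, hl⟩ := hD v
          have hlk : l = k := by
            by_contra hlk
            exact absurd (hl _ (hm l).1) (not_le.2 (hv l hlk))
          subst hlk
          refine ⟨l, fun y hy => ?_⟩
          rcases Finset.mem_insert.1 hy with rfl | hy
          exacts [hx.2 v hv, hl y hy]
        · push Not at hv
          obtain ⟨l, hlk, hl⟩ := hv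
          refine ⟨l, fun y hy => ?_⟩
          rcases Finset.mem_insert.1 hy with rfl | hy
          exacts [hl.trans (hx.1 l hlk).le, hl.trans ((hm l).2 y hy)]
    rintro (hx | hx)
    exacts [key i j hij hmij hx, key j i hij.symm hmij.symm hx]
  · rintro x ⟨hi, hj⟩
    obtain ⟨l, hl⟩ := hD x
    by_cases hli : l = i
    · subst hli
      exact absurd (hl _ (hm l).1) (not_le.2 (hj.1 l hij))
    · exact absurd (hl _ (hm l).1) (not_le.2 (hi.1 l hli))

/-- Removing one point from a set that misses the colour `i₀` leaves all other colours in an even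
number of cases. -/
theorem even_card_erase_image_eq [Fintype I] [DecidableEq I] [DecidableEq V] {c : V → I} {i₀ : I} {R : Finset V}
    (hR : R.card = Fintype.card I) (hc : R.image c ≠ Finset.univ) :
    Even (R.filter fun x => (R.erase x).image c = Finset.univ.erase i₀).card := by
  rcases (R.filter fun x => (R.erase x).image c = Finset.univ.erase i₀).eq_empty_or_nonempty
    with h | ⟨x, hx⟩
  · simp [h]
  obtain ⟨hxR, hx⟩ := Finset.mem_filter.1 hx
  have hcx : c x ≠ i₀ := by
    rintro rfl
    apply hc
    rw [← Finset.insert_erase hxR, Finset.image_insert, hx]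
    exact Finset.insert_erase (Finset.mem_univ _)
  have hinj : Set.InjOn c (R.erase x : Finset V) := by
    rw [← Finset.card_image_iff, hx, Finset.card_erase_of_mem (Finset.mem_univ _),
      Finset.card_erase_of_mem hxR, hR, Finset.card_univ]
  -- `y` is the unique other point with the colour of `x`; only removing one of these two leaves the
  -- required colours.
  obtain ⟨y, hy, hcy⟩ : ∃ y ∈ R.erase x, c y = c x := by
    rw [← Finset.mem_image, hx]
    simpa using hcx
  have hyx : y ≠ x := (Finset.mem_erase.1 hy).1
  have hyR : y ∈ R := (Finset.mem_erase.1 hy).2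
  have : (R.filter fun x => (R.erase x).image c = Finset.univ.erase i₀) = {x, y} := by
    ext z
    simp only [Finset.mem_filter, Finset.mem_insert, Finset.mem_singleton]
    constructor
    · rintro ⟨hzR, hz⟩
      by_contra! h
      have hcz : c z ∈ (R.erase z).image c := by
        rw [hz, ← hx]
        exact Finset.mem_image_of_mem _ (Finset.mem_erase.2 ⟨h.1, hzR⟩)
      obtain ⟨w, hw, hcw⟩ := Finset.mem_image.1 hcz
      obtain ⟨hwz, hwR⟩ := Finset.mem_erase.1 hw
      by_cases hwx : w = x
      · subst hwx
        exact h.2 (hinj (by simp [h.1, hzR]) hy (hcw.symm.trans hcy.symm))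
      · exact hwz (hinj (by simp [hwx, hwR]) (by simp [h.1, hzR]) hcw)
    · rintro (rfl | rfl)
      · exact ⟨hxR, hx⟩
      · refine ⟨hyR, ?_⟩
        rw [← hx]
        ext i
        simp only [Finset.mem_image, Finset.mem_erase]
        constructor
        · rintro ⟨w, ⟨hwz, hwR⟩, rfl⟩
          by_cases hwx : w = x
          · subst hwx; exact ⟨z, ⟨hyx, hyR⟩, hcy⟩
          · exact ⟨w, ⟨hwx, hwR⟩, rfl⟩
        · rintro ⟨w, ⟨hwz, hwR⟩, rfl⟩
          by_cases hwx : w = z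
          · subst hwx; exact ⟨x, ⟨hyx.symm, hxR⟩, hcy.symm⟩
          · exact ⟨w, ⟨hwx, hwR⟩, rfl⟩
  rw [this, Finset.card_pair hyx.symm]
  exact even_two

/-- **Scarf's lemma**: for orders with slack points `s i`, every colouring that gives `s i` the
colour `i` has a dominating set that contains each colour exactly once. -/
theorem exists_isDominating_image_eq_univ [Fintype I] [Nontrivial I] [DecidableEq I] [Fintype V]
    [DecidableEq V] (hr : ∀ i, Function.Injective (r i))
    (s : I → V) (hbot : ∀ l v, r l (s l) ≤ r l v)
    (htop : ∀ l k v, k ≠ l → r l (s k) ≤ r l v → ∃ p, p ≠ l ∧ v = s p)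
    (hne : ∃ v, v ∉ Set.range s) (c : V → I) (hcs : ∀ i, c (s i) = i) :
    ∃ R : Finset V, IsDominating r R ∧ R.image c = Finset.univ := by
  classical
  by_contra! hcon
  obtain ⟨i₀⟩ : Nonempty I := inferInstance
  have hs : Function.Injective s := Function.LeftInverse.injective hcs
  set doors : Finset (Finset V) := Finset.univ.filter fun D =>
    D.card + 1 = Fintype.card I ∧ D.image c = Finset.univ.erase i₀ with hdoors
  set rooms : Finset (Finset V) := Finset.univ.filter fun R =>
    R.card = Fintype.card I ∧ IsDominating r R with hrooms
  -- Incidences between doors and rooms are counted twice. Without a fully coloured room each room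
  -- has evenly many doors, while each door lies in zero or two rooms, except the boundary door
  -- `D₀`, which lies in exactly one.
  have hdc := Finset.sum_card_bipartiteAbove_eq_sum_card_bipartiteBelow
    (s := doors) (t := rooms) (fun D R => D ⊆ R)
  have hroom : ∀ R ∈ rooms, Even (doors.bipartiteBelow (fun D R => D ⊆ R) R).card := by
    intro R hR
    obtain ⟨-, hRc, hRd⟩ := Finset.mem_filter.1 hR
    have := even_card_erase_image_eq (i₀ := i₀) hRc (hcon R hRd)
    rw [← Finset.card_image_of_injOn (f := fun x => R.erase x)] at this
    · convert this using 2
      ext D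
      simp only [Finset.mem_bipartiteBelow, hdoors, Finset.mem_filter, Finset.mem_univ, true_and,
        Finset.mem_image]
      constructor
      · rintro ⟨⟨hD, hDc⟩, hDR⟩
        have : (R \ D).card = 1 := by rw [Finset.card_sdiff_of_subset hDR]; omega
        obtain ⟨x, hx⟩ := Finset.card_eq_one.1 this
        have hxR : x ∈ R \ D := by simp [hx]
        have hDx : R.erase x = D := by
          rw [← Finset.sdiff_singleton_eq_erase, ← hx, Finset.sdiff_sdiff_eq_self hDR]
        exact ⟨x, ⟨(Finset.mem_sdiff.1 hxR).1, hDx ▸ hDc⟩, hDx⟩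
      · rintro ⟨x, ⟨hxR, hx⟩, rfl⟩
        exact ⟨⟨by rw [Finset.card_erase_add_one hxR, hRc], hx⟩, Finset.erase_subset _ _⟩
    · intro x hx y _ hxy
      by_contra hne
      have hx' : x ∈ R := (Finset.mem_filter.1 hx).1
      have : x ∈ R.erase y := Finset.mem_erase.2 ⟨hne, hx'⟩
      rw [← show R.erase x = R.erase y from hxy] at this
      simp at this
  have heven : Even (∑ D ∈ doors, (rooms.bipartiteAbove (fun D R => D ⊆ R) D).card) := by
    rw [hdc]
    exact Finset.even_sum _ hroom
  have habove : ∀ D ∈ doors, (rooms.bipartiteAbove (fun D R => D ⊆ R) D).card =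
      (Finset.univ.filter fun x => x ∉ D ∧ IsDominating r (insert x D)).card := by
    intro D hD
    obtain ⟨-, hDc, -⟩ := Finset.mem_filter.1 hD
    rw [← Finset.card_image_of_injOn (s := Finset.univ.filter _) (f := fun x => insert x D)]
    · congr 1
      ext R
      simp only [Finset.mem_bipartiteAbove, hrooms, Finset.mem_filter, Finset.mem_univ, true_and,
        Finset.mem_image]
      constructor
      · rintro ⟨⟨hR, hRd⟩, hDR⟩
        have : (R \ D).card = 1 := by rw [Finset.card_sdiff_of_subset hDR]; omega
        obtain ⟨x, hx⟩ := Finset.card_eq_one.1 this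
        have hxR : x ∈ R \ D := by simp [hx]
        have hDx : insert x D = R := by
          rw [← Finset.union_sdiff_of_subset hDR, hx, Finset.union_comm, Finset.insert_eq]
        exact ⟨x, ⟨(Finset.mem_sdiff.1 hxR).2, hDx ▸ hRd⟩, hDx⟩
      · rintro ⟨x, ⟨hxD, hx⟩, rfl⟩
        exact ⟨⟨by rw [Finset.card_insert_of_notMem hxD, hDc], hx⟩, Finset.subset_insert _ _⟩
    · intro x hx y _ hxy
      have hx' : x ∉ D := (Finset.mem_filter.1 hx).2.1
      have : x ∈ insert y D := by
        rw [← show insert x D = insert y D from hxy]; exact Finset.mem_insert_self _ _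
      exact (Finset.mem_insert.1 this).resolve_right hx'
  have hmin : ∀ D ∈ doors, ∃ m : I → V, ∀ l, m l ∈ D ∧ ∀ d ∈ D, r l (m l) ≤ r l d := by
    intro D hD
    obtain ⟨-, hDc, -⟩ := Finset.mem_filter.1 hD
    have hDne : D.Nonempty := by
      rw [← Finset.card_pos]
      have := Fintype.one_lt_card (α := I)
      omega
    choose m hm using fun l => D.exists_min_image (r l) hDne
    exact ⟨m, hm⟩
  set D₀ : Finset V := (Finset.univ.erase i₀).image s with hD₀
  have hD₀mem : ∀ {v}, v ∈ D₀ ↔ ∃ p, p ≠ i₀ ∧ v = s p := by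
    intro v
    simp [hD₀, eq_comm]
  have hD₀doors : D₀ ∈ doors := by
    refine Finset.mem_filter.2 ⟨Finset.mem_univ _, ?_, ?_⟩
    · rw [hD₀, Finset.card_image_of_injective _ hs, Finset.card_erase_add_one (Finset.mem_univ _),
        Finset.card_univ]
    · rw [hD₀, Finset.image_image]
      rw [show c ∘ s = id from funext hcs, Finset.image_id]
  have hother : ∀ D ∈ doors, D ≠ D₀ → Even (rooms.bipartiteAbove (fun D R => D ⊆ R) D).card := by
    intro D hD hDD₀
    rw [habove D hD]
    obtain ⟨m, hm⟩ := hmin D hD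
    obtain ⟨-, hDc, hDi⟩ := Finset.mem_filter.1 hD
    by_cases hdom : IsDominating r D
    · obtain ⟨i, j, -, -, hiff, hnot⟩ := hdom.exists_pair hr hm hDc
      have hex : ∀ k, ∃ x, IsTopAbove r m k x := by
        intro k
        -- The slack point `s k` qualifies unless `D` consists of all slack points but `s l`; the
        -- missing colour then gives `l = i₀` and `D = D₀`.
        refine exists_isTopAbove (y := s k) fun l hlk => ?_
        by_contra! hle
        have hDl : D ⊆ (Finset.univ.erase l).image s := by
          intro d hd
          obtain ⟨p, hp, rfl⟩ := htop l k d (Ne.symm hlk) (hle.trans ((hm l).2 d hd))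
          exact Finset.mem_image_of_mem _ (by simpa using hp)
        have hDeq : D = (Finset.univ.erase l).image s := by
          refine Finset.eq_of_subset_of_card_le hDl ?_
          rw [Finset.card_image_of_injective _ hs, Finset.card_erase_of_mem (Finset.mem_univ _),
            Finset.card_univ]
          omega
        have hli : l = i₀ := by
          have h1 : D.image c = Finset.univ.erase l := by
            rw [hDeq, Finset.image_image]
            rw [show c ∘ s = id from funext hcs, Finset.image_id]
          rw [hDi] at h1
          by_contra hne
          have : l ∈ Finset.univ.erase i₀ := Finset.mem_erase.2 ⟨hne, Finset.mem_univ _⟩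
          rw [h1] at this
          simp at this
        exact hDD₀ (by rw [hDeq, hli])
      obtain ⟨x, hx⟩ := hex i
      obtain ⟨y, hy⟩ := hex j
      have hxy : x ≠ y := fun h => hnot x ⟨hx, h ▸ hy⟩
      have : (Finset.univ.filter fun x => x ∉ D ∧ IsDominating r (insert x D)) = {x, y} := by
        ext z
        simp only [Finset.mem_filter, Finset.mem_univ, true_and, Finset.mem_insert,
          Finset.mem_singleton, hiff]
        constructor
        · rintro (h | h)
          exacts [Or.inl (h.eq hr hx), Or.inr (h.eq hr hy)]
        · rintro (rfl | rfl)
          exacts [Or.inl hx, Or.inr hy]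
      rw [this, Finset.card_pair hxy]
      exact even_two
    · rw [Finset.filter_false_of_mem]
      · simp
      · rintro x - ⟨-, hx⟩
        exact hdom (hx.mono (Finset.subset_insert _ _))
  have hbase : Odd (rooms.bipartiteAbove (fun D R => D ⊆ R) D₀).card := by
    rw [habove D₀ hD₀doors]
    obtain ⟨m, hm⟩ := hmin D₀ hD₀doors
    obtain ⟨-, hDc, -⟩ := Finset.mem_filter.1 hD₀doors
    have hdom : IsDominating r D₀ := by
      intro v
      by_cases hv : v ∈ D₀
      · obtain ⟨p, -, rfl⟩ := hD₀mem.1 hv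
        exact ⟨p, fun x _ => hbot p x⟩
      · refine ⟨i₀, fun x hx => ?_⟩
        by_contra! hlt
        obtain ⟨p, hp, rfl⟩ := hD₀mem.1 hx
        exact hv (hD₀mem.2 (htop i₀ p v hp hlt.le))
    have hml : ∀ l, l ≠ i₀ → m l = s l := fun l hl =>
      hr l (le_antisymm ((hm l).2 _ (hD₀mem.2 ⟨l, hl, rfl⟩)) (hbot l _))
    obtain ⟨i, j, hij, hmij, hiff, -⟩ := hdom.exists_pair hr hm hDc
    obtain ⟨p, hp, hpm⟩ := hD₀mem.1 (hm i₀).1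
    -- The colliding orders of `D₀` are `i₀` and `p`. For `p` no point is admissible: above `s p` in
    -- order `i₀` there are only slack points, and each is a minimum that would have to be exceeded
    -- strictly.
    have hnone : ∀ x, ¬ IsTopAbove r m p x := by
      intro x hx
      have h1 := hx.1 i₀ hp.symm
      rw [hpm] at h1
      obtain ⟨q, hq, rfl⟩ := htop i₀ p x hp h1.le
      by_cases hqp : q = p
      · subst hqp; exact lt_irrefl _ h1
      · have := hx.1 q hqp
        rw [hml q hq] at this
        exact lt_irrefl _ this
    have hone : ∃ x, IsTopAbove r m i₀ x := by
      obtain ⟨v, hv⟩ := hne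
      refine exists_isTopAbove (y := v) fun l hl => ?_
      rw [hml l hl]
      exact lt_of_le_of_ne (hbot l v) fun h => hv ⟨l, hr l h⟩
    have hiff' : ∀ x, (x ∉ D₀ ∧ IsDominating r (insert x D₀)) ↔ IsTopAbove r m i₀ x := by
      intro x
      rw [hiff]
      by_cases hi : i = i₀
      · have hj : j = p := by
          rw [hi, hpm, hml j (by rintro rfl; exact hij hi)] at hmij
          exact (hs hmij).symm
        simp [hi, hj, hnone]
      · have hj : j = i₀ := by
          by_contra hj
          rw [hml i hi, hml j hj] at hmij
          exact hij (hs hmij)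
        have hi' : i = p := by
          rw [hj, hpm, hml i hi] at hmij
          exact hs hmij
        simp [hi', hj, hnone]
    obtain ⟨x, hx⟩ := hone
    have : (Finset.univ.filter fun x => x ∉ D₀ ∧ IsDominating r (insert x D₀)) = {x} := by
      ext z
      simp only [Finset.mem_filter, Finset.mem_univ, true_and, Finset.mem_singleton, hiff']
      exact ⟨fun h => h.eq hr hx, fun h => h ▸ hx⟩
    rw [this, Finset.card_singleton]
    exact odd_one
  rw [← Finset.add_sum_erase _ _ hD₀doors] at heven
  have hrest : Even (∑ D ∈ doors.erase D₀, (rooms.bipartiteAbove (fun D R => D ⊆ R) D).card) :=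
    Finset.even_sum _ fun D hD => hother D (Finset.mem_erase.1 hD).2 (Finset.mem_erase.1 hD).1
  exact (Nat.not_even_iff_odd.2 (hbase.add_even hrest)) heven

end Scarf

/-! ### Brouwer's theorem on the simplex -/

/-- The rank of a grid point (`inl`) or slack point (`inr`) for the coordinate `l`: slack points
other than the `l`-th one lie above all grid points, and ties are broken by the enumeration `e`. -/
def gridRank {I V : Type*} [DecidableEq I] {m : ℕ} {t : Finset (I → ℕ)} (e : ↥t ⊕ I → V) (l : I) :
    ↥t ⊕ I → ℕ ×ₗ V :=
  fun v => toLex (Sum.elim (fun x => x.1 l + 1) (fun k => if k = l then 0 else m + 2) v, e v)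

/-- A colouring of the standard simplex has, at every scale `m`, a point `x` each of whose
coordinates is small or whose index is the colour of a point near `x`. -/
theorem exists_mem_stdSimplex_near_colour {I : Type*} [Fintype I] [Nontrivial I]
    (c : (I → ℝ) → I) {m : ℕ} (hm : 0 < m) :
    ∃ x ∈ stdSimplex ℝ I, ∀ i, x i ≤ Fintype.card I / m ∨
      ∃ y ∈ stdSimplex ℝ I, dist x y ≤ Fintype.card I / m ∧ c y = i := by
  classical
  set t : Finset (I → ℕ) := Finset.piAntidiag Finset.univ m with ht
  have htmem : ∀ {x : I → ℕ}, x ∈ t ↔ ∑ i, x i = m := by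
    intro x; simp [ht, Finset.mem_piAntidiag]
  have hmR : (0 : ℝ) < m := by exact_mod_cast hm
  set pt : (I → ℕ) → I → ℝ := fun x i => x i / m with hpt
  have hptmem : ∀ x ∈ t, pt x ∈ stdSimplex ℝ I := by
    intro x hx
    refine ⟨fun i => by positivity, ?_⟩
    rw [hpt, ← Finset.sum_div, ← Nat.cast_sum, htmem.1 hx, div_self hmR.ne']
  let e := Fintype.equivFin (↥t ⊕ I)
  have hle : ∀ {l v w}, gridRank (m := m) e l v ≤ gridRank (m := m) e l w →
      Sum.elim (fun x : ↥t => x.1 l + 1) (fun k => if k = l then 0 else m + 2) v ≤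
      Sum.elim (fun x : ↥t => x.1 l + 1) (fun k => if k = l then 0 else m + 2) w := by
    intro l v w h
    rcases (Prod.Lex.toLex_le_toLex).1 h with h | h
    exacts [h.le, h.1.le]
  have hcoord : ∀ (x : ↥t) l, x.1 l ≤ m := by
    intro x l
    rw [← htmem.1 x.2]
    exact Finset.single_le_sum (f := x.1) (fun _ _ => Nat.zero_le _) (Finset.mem_univ l)
  obtain ⟨i₀⟩ : Nonempty I := inferInstance
  have hpi : Pi.single i₀ m ∈ t := htmem.2 (by simp)
  obtain ⟨R, hR, hRc⟩ := exists_isDominating_image_eq_univ (r := gridRank (m := m) e)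
    (fun l v w h => e.injective (congrArg (fun p => (ofLex p).2) h)) (fun i => Sum.inr i)
    (fun l v => by
      rcases v with v | k
      · exact Prod.Lex.toLex_le_toLex.2 (Or.inl (by simp))
      · by_cases hk : k = l
        · subst hk; exact le_rfl
        · exact Prod.Lex.toLex_le_toLex.2 (Or.inl (by simp [hk])))
    (fun l k v hk h => by
      have := hle h
      rcases v with v | p
      · have h2 := hcoord v l
        simp [hk] at this
        omega
      · refine ⟨p, ?_, rfl⟩
        rintro rfl
        simp [hk] at this)
    ⟨Sum.inl ⟨_, hpi⟩, by simp⟩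
    (Sum.elim (fun x => c (pt x.1)) id) (fun i => rfl)
  set C : Finset I := Finset.univ.filter fun i => Sum.inr i ∉ R with hC
  have hcol : ∀ i ∈ C, ∃ x : ↥t, Sum.inl x ∈ R ∧ c (pt x.1) = i := by
    intro i hi
    have : i ∈ R.image (Sum.elim (fun x => c (pt x.1)) id) := by rw [hRc]; exact Finset.mem_univ _
    obtain ⟨v, hv, hvi⟩ := Finset.mem_image.1 this
    rcases v with x | k
    · exact ⟨x, hv, hvi⟩
    · have : k = i := hvi
      subst this
      exact absurd hv (Finset.mem_filter.1 hi).2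
  -- The shift by one in the rank puts the `i`-th slack point strictly below every grid point in
  -- order `i`, so an order dominating a grid point has its slack point outside `R`.
  have hdom : ∀ y : ↥t, ∃ i ∈ C, ∀ x : ↥t, Sum.inl x ∈ R → y.1 i ≤ x.1 i := by
    intro y
    obtain ⟨i, hi⟩ := hR (Sum.inl y)
    refine ⟨i, Finset.mem_filter.2 ⟨Finset.mem_univ _, fun h => ?_⟩, fun x hx => ?_⟩
    · have := hle (hi _ h)
      simp at this
    · have := hle (hi _ hx)
      simpa using this
  obtain ⟨i₁, hi₁, -⟩ := hdom ⟨_, hpi⟩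
  obtain ⟨x₀, hx₀, -⟩ := hcol i₁ hi₁
  set R' : Finset ↥t := Finset.univ.filter fun x => Sum.inl x ∈ R with hR'
  have hmin : ∀ i, ∃ x ∈ R', ∀ y ∈ R', x.1 i ≤ y.1 i := fun i =>
    R'.exists_min_image (fun x => x.1 i) ⟨x₀, by simpa [hR'] using hx₀⟩
  choose q hqR hq using hmin
  set a : I → ℕ := fun i => if i ∈ C then (q i).1 i else 0 with ha
  have hale : ∀ x ∈ R', ∀ i, a i ≤ x.1 i := by
    intro x hx i
    by_cases hi : i ∈ C
    · simpa [ha, hi] using hq i x hx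
    · simp [ha, hi]
  -- Otherwise some grid point is at least `a + 1` in every coordinate, and no order in `C`
  -- dominates it. With coordinate sums equal to `m`, this confines all grid points of `R` to a box
  -- of side `card I` above `a`.
  have hsum : m ≤ ∑ i, a i + Fintype.card I := by
    by_contra! hlt
    set b : I → ℕ := fun i => a i + 1 with hb
    have hbs : ∑ i, b i ≤ m := by
      simp only [hb, Finset.sum_add_distrib, Finset.sum_const, Finset.card_univ, smul_eq_mul,
        mul_one]
      omega
    obtain ⟨i, hi, hy⟩ := hdom ⟨b + (Pi.single i₁ (m - ∑ i, b i) : I → ℕ), htmem.2 (by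
      simp only [Pi.add_apply, Finset.sum_add_distrib, Finset.sum_pi_single', Finset.mem_univ,
        if_true]
      omega)⟩
    have h1 := hy (q i) (by simpa [hR'] using hqR i)
    have h2 : a i = (q i).1 i := by simp [ha, hi]
    have h3 : b i ≤ (b + (Pi.single i₁ (m - ∑ i, b i) : I → ℕ)) i := by simp
    have h4 : b i = a i + 1 := rfl
    have h5 := h3.trans h1
    omega
  have hclose : ∀ x ∈ R', ∀ i, x.1 i ≤ a i + Fintype.card I := by
    intro x hx i
    have h1 : ∑ i, x.1 i = m := htmem.1 x.2
    have h2 : ∑ j ∈ Finset.univ.erase i, a j ≤ ∑ j ∈ Finset.univ.erase i, x.1 j :=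
      Finset.sum_le_sum fun j _ => hale x hx j
    rw [← Finset.add_sum_erase _ _ (Finset.mem_univ i)] at h1 hsum
    omega
  have hx₀R : x₀ ∈ R' := by simpa [hR'] using hx₀
  refine ⟨pt x₀.1, hptmem _ x₀.2, fun i => ?_⟩
  by_cases hi : i ∈ C
  · right
    obtain ⟨y, hy, hyi⟩ := hcol i hi
    have hyR : y ∈ R' := by simpa [hR'] using hy
    refine ⟨pt y.1, hptmem _ y.2, ?_, hyi⟩
    rw [dist_pi_le_iff (by positivity)]
    intro j
    rw [Real.dist_eq, hpt]
    simp only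
    rw [← sub_div, abs_div, abs_of_pos hmR]
    gcongr
    rw [abs_sub_le_iff]
    have h1 : (x₀.1 j : ℝ) ≤ a j + Fintype.card I := by exact_mod_cast hclose _ hx₀R j
    have h2 : (y.1 j : ℝ) ≤ a j + Fintype.card I := by exact_mod_cast hclose _ hyR j
    have h3 : (a j : ℝ) ≤ x₀.1 j := by exact_mod_cast hale _ hx₀R j
    have h4 : (a j : ℝ) ≤ y.1 j := by exact_mod_cast hale _ hyR j
    constructor <;> linarith
  · left
    have h1 : (x₀.1 i : ℝ) ≤ Fintype.card I := by
      have := hclose _ hx₀R i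
      simp only [ha, hi, if_false, zero_add] at this
      exact_mod_cast this
    simp only [hpt]
    gcongr

/-- **Brouwer's fixed point theorem** for the standard simplex. -/
theorem exists_fixedPoint_stdSimplex {I : Type*} [Fintype I] [Nonempty I]
    {f : (I → ℝ) → I → ℝ} (hf : ContinuousOn f (stdSimplex ℝ I))
    (hmaps : Set.MapsTo f (stdSimplex ℝ I) (stdSimplex ℝ I)) :
    ∃ x ∈ stdSimplex ℝ I, f x = x := by
  classical
  suffices h : ∃ x ∈ stdSimplex ℝ I, ∀ i, x i ≤ f x i by
    obtain ⟨x, hx, hle⟩ := h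
    refine ⟨x, hx, funext fun i => ?_⟩
    have := (Finset.sum_eq_sum_iff_of_le (s := Finset.univ) fun i _ => hle i).1
      (hx.2.trans (hmaps hx).2.symm)
    exact (this i (Finset.mem_univ _)).symm
  rcases subsingleton_or_nontrivial I with hI | hI
  · obtain ⟨i₀⟩ : Nonempty I := inferInstance
    have hx := single_mem_stdSimplex ℝ i₀
    refine ⟨_, hx, fun i => ?_⟩
    have h1 := hx.2
    have h2 := (hmaps hx).2
    rw [Fintype.sum_subsingleton _ i] at h1 h2
    rw [h1, h2]
  have hcpt : IsCompact (stdSimplex ℝ I) := isCompact_stdSimplex ℝ I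
  -- A coordinate that `f` does not decrease serves as the colour; one exists because both
  -- coordinate sums are 1.
  have hcol : ∀ x : I → ℝ, ∃ i, x ∈ stdSimplex ℝ I → x i ≤ f x i := by
    intro x
    by_cases hx : x ∈ stdSimplex ℝ I
    · obtain ⟨i, -, hi⟩ := Finset.exists_le_of_sum_le (s := Finset.univ) (f := x) (g := f x)
        Finset.univ_nonempty (hx.2.trans (hmaps hx).2.symm).le
      exact ⟨i, fun _ => hi⟩
    · exact ⟨Classical.arbitrary I, fun h => absurd h hx⟩
  choose c hc using hcol
  have happrox : ∀ ε > 0, ∃ x ∈ stdSimplex ℝ I, ∀ i, x i - f x i ≤ ε := by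
    intro ε hε
    obtain ⟨δ, hδ, hfδ⟩ := Metric.uniformContinuousOn_iff.1
      (hcpt.uniformContinuousOn_of_continuous hf) (ε / 2) (half_pos hε)
    obtain ⟨m, hm⟩ := exists_nat_gt (Fintype.card I / min δ (ε / 2))
    have hmin : 0 < min δ (ε / 2) := lt_min hδ (half_pos hε)
    have hmR : (0 : ℝ) < m := lt_of_le_of_lt (by positivity) hm
    have hsmall : (Fintype.card I : ℝ) / m < min δ (ε / 2) := by
      rwa [div_lt_iff₀ hmR, mul_comm, ← div_lt_iff₀ hmin]
    obtain ⟨x, hx, h⟩ := exists_mem_stdSimplex_near_colour c (m := m) (by exact_mod_cast hmR)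
    refine ⟨x, hx, fun i => ?_⟩
    rcases h i with h | ⟨y, hy, hxy, hyi⟩
    · have := (hmaps hx).1 i
      have := min_le_right δ (ε / 2)
      linarith
    · have h1 := hfδ x hx y hy (hxy.trans_lt (hsmall.trans_le (min_le_left _ _)))
      have h2 := hc y hy
      rw [hyi] at h2
      have h3 := (dist_le_pi_dist x y i).trans (hxy.trans (hsmall.le.trans (min_le_right _ _)))
      have h4 := (dist_le_pi_dist (f x) (f y) i).trans h1.le
      rw [Real.dist_eq] at h3 h4
      have := abs_le.1 h3
      have := abs_le.1 h4
      linarith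
  -- Minimise the total decrease of the coordinates. The factor `2 * card I` below makes an
  -- approximate solution beat half of any positive decrease at the minimiser.
  have hg : ContinuousOn (fun x => ∑ i, max (x i - f x i) 0) (stdSimplex ℝ I) :=
    continuousOn_finsetSum _ fun i _ =>
      (((continuous_apply i).continuousOn.sub (continuousOn_pi.1 hf i)).sup continuousOn_const)
  obtain ⟨x, hx, hxmin⟩ := hcpt.exists_isMinOn ⟨_, single_mem_stdSimplex ℝ (Classical.arbitrary I)⟩ hg
  refine ⟨x, hx, fun i => ?_⟩
  by_contra! hlt
  have hpos : 0 < x i - f x i := sub_pos.2 hlt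
  have hn : (0 : ℝ) < Fintype.card I := by exact_mod_cast Fintype.card_pos
  obtain ⟨y, hy, hyle⟩ := happrox ((x i - f x i) / (2 * Fintype.card I)) (by positivity)
  have h1 : ∑ i, max (y i - f y i) 0 ≤ (x i - f x i) / 2 := by
    calc ∑ j, max (y j - f y j) 0 ≤ ∑ _j : I, (x i - f x i) / (2 * Fintype.card I) :=
          Finset.sum_le_sum fun j _ => max_le (hyle j) (by positivity)
      _ = (x i - f x i) / 2 := by
          rw [Finset.sum_const, Finset.card_univ, nsmul_eq_mul]; field_simp
  have h2 : x i - f x i ≤ ∑ j, max (x j - f x j) 0 :=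
    (le_max_left _ _).trans (Finset.single_le_sum (f := fun j => max (x j - f x j) 0)
      (fun j _ => le_max_right _ _) (Finset.mem_univ i))
  have h3 : ∑ j, max (x j - f x j) 0 ≤ ∑ j, max (y j - f y j) 0 := hxmin hy
  linarith

/-! ### Kakutani's theorem -/

open Set in
/-- A correspondence into a compact set with closed graph is upper hemicontinuous (metric form). -/
theorem exists_ball_image_subset_thickening {E : Type*} [MetricSpace E] {A : Set E}
    (hA : IsCompact A) {F : E → Set E} (hFA : ∀ x ∈ A, F x ⊆ A)
    (hgraph : IsClosed {p : E × E | p.1 ∈ A ∧ p.2 ∈ F p.1}) (x : E) {δ : ℝ} (hδ : 0 < δ) :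
    ∃ η > 0, ∀ y ∈ A, dist y x < η → F y ⊆ Metric.thickening δ (F x) := by
  have hB : IsCompact ({p : E × E | p.1 ∈ A ∧ p.2 ∈ F p.1} \ (univ ×ˢ Metric.thickening δ (F x))) := by
    refine ((hA.prod hA).of_isClosed_subset hgraph ?_).diff
      (isOpen_univ.prod Metric.isOpen_thickening)
    rintro p ⟨h1, h2⟩
    exact ⟨h1, hFA _ h1 h2⟩
  have hx : x ∈ (Prod.fst '' ({p : E × E | p.1 ∈ A ∧ p.2 ∈ F p.1} \
      (univ ×ˢ Metric.thickening δ (F x))))ᶜ := by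
    rintro ⟨⟨y, z⟩, ⟨⟨-, hz⟩, hn⟩, rfl⟩
    exact hn ⟨mem_univ _, Metric.self_subset_thickening hδ _ hz⟩
  obtain ⟨η, hη, hball⟩ := Metric.isOpen_iff.1 (hB.image continuous_fst).isClosed.isOpen_compl x hx
  refine ⟨η, hη, fun y hy hyx z hz => ?_⟩
  by_contra hn
  exact hball hyx ⟨(y, z), ⟨⟨hy, hz⟩, fun h => hn h.2⟩, rfl⟩

/-- For every `ε`, there is a point `x` in the convex hull of the values at points `ε`-near `x`. -/
theorem exists_mem_convexHull_near {E : Type*} [NormedAddCommGroup E] [NormedSpace ℝ E] {A : Set E}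
    (hA : IsCompact A) (hAconv : Convex ℝ A) (hAne : A.Nonempty) {F : E → Set E}
    (hFA : ∀ x ∈ A, F x ⊆ A) (hFne : ∀ x ∈ A, (F x).Nonempty) {ε : ℝ} (hε : 0 < ε) :
    ∃ x ∈ A, x ∈ convexHull ℝ (⋃ y ∈ A ∩ Metric.ball x ε, F y) := by
  classical
  obtain ⟨t, htA, htfin, hcover⟩ := hA.finite_cover_balls hε
  have : Fintype t := htfin.fintype
  obtain ⟨a, ha⟩ := hAne
  have : Nonempty t := by
    obtain ⟨y, hy, -⟩ := Set.mem_iUnion₂.1 (hcover ha)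
    exact ⟨⟨y, hy⟩⟩
  choose v hv using fun i : t => hFne i (htA i.2)
  have hvA : ∀ i, v i ∈ A := fun i => hFA _ (htA i.2) (hv i)
  set p : (t → ℝ) → E := fun l => ∑ i, l i • v i with hp
  have hpA : ∀ l ∈ stdSimplex ℝ t, p l ∈ A := fun l hl =>
    hAconv.sum_mem (fun i _ => hl.1 i) hl.2 fun i _ => hvA i
  have hpc : Continuous p := by fun_prop
  -- Hat functions of radius `ε`: after normalisation only centres within `ε` of `p l` get weight,
  -- and a fixed point `l` is its own weight vector.
  set w : t → E → ℝ := fun i x => max (ε - dist x i) 0 with hw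
  have hwc : ∀ i, Continuous (w i) := fun i => by fun_prop
  have hw0 : ∀ i x, 0 ≤ w i x := fun i x => le_max_right _ _
  have hS : ∀ x ∈ A, 0 < ∑ i, w i x := by
    intro x hx
    obtain ⟨y, hy, hxy⟩ := Set.mem_iUnion₂.1 (hcover hx)
    refine Finset.sum_pos' (fun i _ => hw0 i x) ⟨⟨y, hy⟩, Finset.mem_univ _, ?_⟩
    exact lt_max_of_lt_left (sub_pos.2 hxy)
  obtain ⟨l, hl, hfix⟩ := exists_fixedPoint_stdSimplex (I := t)
    (f := fun l i => w i (p l) / ∑ j, w j (p l))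
    (continuousOn_pi.2 fun i => ContinuousOn.div ((hwc i).comp hpc).continuousOn
      (continuous_finsetSum _ fun j _ => (hwc j).comp hpc).continuousOn
      fun l hl => (hS _ (hpA l hl)).ne')
    (fun l hl => ⟨fun i => div_nonneg (hw0 _ _) (Finset.sum_nonneg fun j _ => hw0 _ _), by
      rw [← Finset.sum_div, div_self (hS _ (hpA l hl)).ne']⟩)
  refine ⟨p l, hpA l hl, ?_⟩
  have hnear : ∀ i, l i ≠ 0 → v i ∈ ⋃ y ∈ A ∩ Metric.ball (p l) ε, F y := by
    intro i hi
    refine Set.mem_iUnion₂.2 ⟨i, ⟨htA i.2, ?_⟩, hv i⟩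
    by_contra hdist
    apply hi
    rw [Metric.mem_ball, not_lt, dist_comm] at hdist
    rw [← congrFun hfix i]
    simp only [hw, max_eq_right (sub_nonpos.2 hdist), zero_div]
  obtain ⟨i₀, hi₀⟩ : ∃ i, l i ≠ 0 := by
    by_contra! h
    have := hl.2
    simp [h] at this
  -- Vertices of weight zero may be far away; they are replaced by `v i₀` so that every term lies in
  -- the hull.
  have hpl : p l = ∑ i, l i • (if l i = 0 then v i₀ else v i) := by
    refine Finset.sum_congr rfl fun i _ => ?_
    split_ifs with h <;> simp [h]
  rw [hpl]
  refine (convex_convexHull ℝ _).sum_mem (fun i _ => hl.1 i) hl.2 fun i _ => ?_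
  rw [← hpl]
  split_ifs with h
  exacts [subset_convexHull ℝ _ (hnear i₀ hi₀), subset_convexHull ℝ _ (hnear i h)]

/-- **Kakutani's fixed point theorem** for a compact convex set of a normed space. -/
theorem exists_mem_of_isClosed_graph {E : Type*} [NormedAddCommGroup E] [NormedSpace ℝ E]
    {A : Set E} (hA : IsCompact A) (hAconv : Convex ℝ A) (hAne : A.Nonempty) {F : E → Set E}
    (hFA : ∀ x ∈ A, F x ⊆ A) (hFne : ∀ x ∈ A, (F x).Nonempty) (hFconv : ∀ x ∈ A, Convex ℝ (F x))
    (hgraph : IsClosed {p : E × E | p.1 ∈ A ∧ p.2 ∈ F p.1}) :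
    ∃ x ∈ A, x ∈ F x := by
  choose u huA hu using fun k : ℕ => exists_mem_convexHull_near hA hAconv hAne hFA hFne
    (ε := 1 / ((k : ℝ) + 1)) Nat.one_div_pos_of_nat
  obtain ⟨x, hx, φ, hφ, hlim⟩ := hA.tendsto_subseq huA
  refine ⟨x, hx, ?_⟩
  have hFcl : IsClosed (F x) := by
    have : F x = (fun y => (x, y)) ⁻¹' {p : E × E | p.1 ∈ A ∧ p.2 ∈ F p.1} := by
      ext y; simp [hx]
    rw [this]
    exact hgraph.preimage (by fun_prop)
  rw [← hFcl.closure_eq, Metric.closure_eq_iInter_cthickening]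
  refine Set.mem_iInter₂.2 fun δ hδ => ?_
  obtain ⟨η, hη, hball⟩ := exists_ball_image_subset_thickening hA hFA hgraph x hδ
  have h1 : ∀ᶠ k in Filter.atTop, dist (u (φ k)) x < η / 2 :=
    hlim.eventually (Metric.ball_mem_nhds x (half_pos hη))
  have h2 : ∀ᶠ k in Filter.atTop, 1 / ((φ k : ℝ) + 1) < η / 2 :=
    (tendsto_one_div_add_atTop_nhds_zero_nat.comp hφ.tendsto_atTop).eventually
      (gt_mem_nhds (half_pos hη))
  refine Metric.isClosed_cthickening.mem_of_tendsto hlim ?_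
  filter_upwards [h1, h2] with k hk1 hk2
  -- The thickening of the convex set `F x` is convex, so it contains the hull of the nearby values,
  -- hence `u (φ k)`.
  refine Metric.thickening_subset_cthickening _ _
    (convexHull_min ?_ ((hFconv x hx).thickening δ) (hu (φ k)))
  refine Set.iUnion₂_subset fun y hy => hball y hy.1 ?_
  have h3 : dist y (u (φ k)) < 1 / ((φ k : ℝ) + 1) := hy.2
  linarith [dist_triangle y (u (φ k)) x]

/-! ### Pseudo-continuity, set-valued maps and projections -/

open Topology

theorem Seminorm.continuous_of_finiteDimensional {E : Type*} [NormedAddCommGroup E]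
    [NormedSpace ℝ E] [FiniteDimensional ℝ E] (p : Seminorm ℝ E) : Continuous p :=
  continuousOn_univ.1 (p.convexOn.continuousOn isOpen_univ)

/-- A value strictly between `f x` and `f y` separates neighbourhoods. If there is none, points near
`y` have values at least `f y`, while points near `x` stay below `f y`. -/
theorem PseudoContinuous.isOpen_lt {Y : Type*} [TopologicalSpace Y] {f : Y → ℝ}
    (hf : PseudoContinuous f) : IsOpen {p : Y × Y | f p.1 < f p.2} := by
  have hup : ∀ {x y}, f x < f y → ∀ᶠ x' in 𝓝 x, f x' < f y := by
    intro x y h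
    obtain ⟨V, hV, hVf⟩ := hf.1 x y h
    exact Filter.mem_of_superset hV hVf
  have hlow : ∀ {x y}, f x < f y → ∀ᶠ y' in 𝓝 y, f x < f y' := by
    intro x y h
    obtain ⟨V, hV, hVf⟩ := hf.2 y x (neg_lt_neg h)
    exact Filter.mem_of_superset hV fun z hz => neg_lt_neg_iff.1 (hVf z hz)
  rw [isOpen_iff_mem_nhds]
  rintro ⟨x, y⟩ (h : f x < f y)
  rw [nhds_prod_eq]
  by_cases hc : ∃ c, f x < f c ∧ f c < f y
  · obtain ⟨c, hxc, hcy⟩ := hc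
    filter_upwards [(hup hxc).prod_mk (hlow hcy)] with p hp using hp.1.trans hp.2
  · push Not at hc
    filter_upwards [(hup h).prod_mk (hlow h)] with p hp
    refine lt_of_not_ge fun hle => ?_
    exact absurd hp.1 (not_lt.2 ((hc p.2 hp.2).trans hle))

/-- A function whose strict upper level sets at its own values are open attains its minimum on
compact sets. -/
theorem IsCompact.exists_forall_le_of_isOpen_lt {Z : Type*} [TopologicalSpace Z] {S : Set Z}
    (hS : IsCompact S) (hne : S.Nonempty) {g : Z → ℝ} (hg : ∀ w, IsOpen {z | g w < g z}) :
    ∃ z ∈ S, ∀ w ∈ S, g z ≤ g w := by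
  by_contra! hcon
  -- Without a minimiser these sets cover `S`, yet the lowest of finitely many centres is in none of
  -- its subcover.
  obtain ⟨t, ht⟩ := hS.elim_finite_subcover (fun w : S => {z | g w < g z}) (fun w => hg w)
    fun z hz => by
      obtain ⟨w, hw, hlt⟩ := hcon z hz
      exact Set.mem_iUnion.2 ⟨⟨w, hw⟩, hlt⟩
  have htne : t.Nonempty := by
    obtain ⟨z, hz⟩ := hne
    obtain ⟨w, hw, -⟩ := Set.mem_iUnion₂.1 (ht hz)
    exact ⟨w, hw⟩
  obtain ⟨w, hwt, hw⟩ := t.exists_min_image (fun w => g w) htne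
  obtain ⟨v, hvt, hv⟩ := Set.mem_iUnion₂.1 (ht w.2)
  exact absurd (hw v hvt) (not_le.2 hv)

theorem UpperHemicontinuousOn.isClosed_graph {Y Z : Type*} [TopologicalSpace Y]
    [TopologicalSpace Z] [T2Space Z] {T : Y → Set Z} {s : Set Y} (hT : UpperHemicontinuousOn T s)
    (hs : IsClosed s) (hcomp : ∀ x ∈ s, IsCompact (T x)) :
    IsClosed {p : Y × Z | p.1 ∈ s ∧ p.2 ∈ T p.1} := by
  rw [← isOpen_compl_iff, isOpen_iff_mem_nhds]
  rintro ⟨x, z⟩ hxz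
  rw [nhds_prod_eq]
  by_cases hx : x ∈ s
  · have hz : z ∉ T x := fun h => hxz ⟨hx, h⟩
    obtain ⟨U, V, hU, hV, hTU, hzV, hUV⟩ := (hcomp x hx).separation_of_notMem hz
    have h1 := eventually_nhdsWithin_iff.1 (hT.forall_isOpen x hx U hU hTU)
    filter_upwards [h1.prod_mk (hV.mem_nhds hzV)] with p hp hmem
    exact hUV.le_bot ⟨hp.1 hmem.1 hmem.2, hp.2⟩
  · filter_upwards [Filter.Eventually.prod_inl (hs.isOpen_compl.mem_nhds hx) (𝓝 z)] with p hp hmem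
    exact hp hmem.1

theorem UpperHemicontinuousOn.exists_subset_closedBall {Y Z : Type*} [TopologicalSpace Y]
    [SeminormedAddCommGroup Z] {T : Y → Set Z} {s : Set Y} (hT : UpperHemicontinuousOn T s)
    (hs : IsCompact s) (hbdd : ∀ x ∈ s, Bornology.IsBounded (T x)) :
    ∃ r, ∀ x ∈ s, T x ⊆ Metric.closedBall 0 r := by
  refine hs.induction_on (p := fun u => ∃ r, ∀ x ∈ u, T x ⊆ Metric.closedBall 0 r)
    ⟨0, by simp⟩ ?_ ?_ ?_
  · rintro u v huv ⟨r, hr⟩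
    exact ⟨r, fun x hx => hr x (huv hx)⟩
  · rintro u v ⟨r, hr⟩ ⟨r', hr'⟩
    refine ⟨max r r', ?_⟩
    rintro x (hx | hx)
    exacts [(hr x hx).trans (Metric.closedBall_subset_closedBall (le_max_left _ _)),
      (hr' x hx).trans (Metric.closedBall_subset_closedBall (le_max_right _ _))]
  · intro x hx
    obtain ⟨r, hr⟩ := (hbdd x hx).subset_ball 0
    exact ⟨_, hT.forall_isOpen x hx _ Metric.isOpen_ball hr, r, fun y hy =>
      Set.Subset.trans hy Metric.ball_subset_closedBall⟩

/-- A witness `w` with `(q, w) ∈ Ω` persists nearby by lower hemicontinuity. With `Ω` the relation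
of strict improvement, this closes the optimality condition. -/
theorem LowerHemicontinuousOn.isClosed_forall_notMem {Y Q Z : Type*} [TopologicalSpace Y]
    [TopologicalSpace Q] [TopologicalSpace Z] {T : Y → Set Z} {s : Set Y}
    (hT : LowerHemicontinuousOn T s) (hs : IsClosed s) {Ω : Set (Q × Z)} (hΩ : IsOpen Ω) :
    IsClosed {p : Y × Q | p.1 ∈ s ∧ ∀ w ∈ T p.1, (p.2, w) ∉ Ω} := by
  rw [← isOpen_compl_iff, isOpen_iff_mem_nhds]
  rintro ⟨x, q⟩ hxq
  rw [nhds_prod_eq]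
  by_cases hx : x ∈ s
  · obtain ⟨w, hw, hqw⟩ : ∃ w ∈ T x, (q, w) ∈ Ω := by
      by_contra! h
      exact hxq ⟨hx, h⟩
    obtain ⟨N, U, hN, hU, hqN, hwU, hNU⟩ := isOpen_prod_iff.1 hΩ q w hqw
    have h1 := eventually_nhdsWithin_iff.1 (hT x hx U ⟨hU, w, hw, hwU⟩)
    filter_upwards [h1.prod_mk (hN.mem_nhds hqN)] with p hp hmem
    obtain ⟨-, v, hv, hvU⟩ := hp.1 hmem.1
    exact hmem.2 v hv (hNU ⟨hp.2, hvU⟩)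
  · filter_upwards [Filter.Eventually.prod_inl (hs.isOpen_compl.mem_nhds hx) (𝓝 q)] with p hp hmem
    exact hp hmem.1

theorem convex_projectionSet {E : Type*} [AddCommGroup E] [Module ℝ E] (nrm : Seminorm ℝ E)
    {A : Set E} (hA : Convex ℝ A) (z : E) : Convex ℝ (projectionSet nrm A z) := by
  intro u hu v hv a b ha hb hab
  refine ⟨hA hu.1 hv.1 ha hb hab, fun x hx => ?_⟩
  have h : z - (a • u + b • v) = a • (z - u) + b • (z - v) := by
    have : z = a • z + b • z := by rw [← add_smul, hab, one_smul]
    rw [smul_sub, smul_sub]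
    nth_rewrite 1 [this]
    abel
  calc nrm (z - (a • u + b • v)) ≤ nrm (a • (z - u)) + nrm (b • (z - v)) := h ▸ map_add_le_add _ _ _
    _ = a * nrm (z - u) + b * nrm (z - v) := by
        rw [map_smul_eq_mul, map_smul_eq_mul, Real.norm_of_nonneg ha, Real.norm_of_nonneg hb]
    _ ≤ a * nrm (z - x) + b * nrm (z - x) := by
        gcongr
        exacts [hu.2 x hx, hv.2 x hx]
    _ = nrm (z - x) := by rw [← add_mul, hab, one_mul]

theorem projectionSet_nonempty {E : Type*} [NormedAddCommGroup E] [NormedSpace ℝ E]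
    [FiniteDimensional ℝ E] (nrm : Seminorm ℝ E) {A : Set E} (hA : IsCompact A) (hne : A.Nonempty)
    (z : E) : (projectionSet nrm A z).Nonempty := by
  obtain ⟨w, hw, hmin⟩ := hA.exists_isMinOn hne
    (nrm.continuous_of_finiteDimensional.comp (continuous_const.sub continuous_id)).continuousOn
  exact ⟨w, hw, fun x hx => hmin hx⟩

theorem isClosed_setOf_mem_projectionSet {E : Type*} [NormedAddCommGroup E] [NormedSpace ℝ E]
    [FiniteDimensional ℝ E] (nrm : Seminorm ℝ E) {A : Set E} (hA : IsClosed A) :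
    IsClosed {p : E × E | p.2 ∈ projectionSet nrm A p.1} := by
  have hn := nrm.continuous_of_finiteDimensional
  have : {p : E × E | p.2 ∈ projectionSet nrm A p.1} =
      Prod.snd ⁻¹' A ∩ ⋂ x ∈ A, {p : E × E | nrm (p.1 - p.2) ≤ nrm (p.1 - x)} := by
    ext p; simp [projectionSet]
  rw [this]
  exact (hA.preimage continuous_snd).inter (isClosed_biInter fun x _ =>
    isClosed_le (hn.comp (continuous_fst.sub continuous_snd))
      (hn.comp (continuous_fst.sub continuous_const)))

/-! ### The fixed point and the projected solution -/

theorem theorem3p1 {N : Type*} [Fintype N] [Nonempty N] [DecidableEq N] (n : N → ℕ)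
    (nrm : Seminorm ℝ (JointSpace n)) (hnrm : ∀ x, nrm x = 0 → x = 0)
    (K : (ν : N) → Set (Fin (n ν) → ℝ))
    (hKconv : ∀ ν, Convex ℝ (K ν)) (hKcomp : ∀ ν, IsCompact (K ν))
    (hKne : ∀ ν, (K ν).Nonempty)
    (X : (ν : N) → JointSpace n → Set (Fin (n ν) → ℝ))
    (hXcont : ∀ ν, SetValuedContinuousOn (X ν) (Set.univ.pi K))
    (hXconv : ∀ ν, ∀ x ∈ Set.univ.pi K, Convex ℝ (X ν x))
    (hXcomp : ∀ ν, ∀ x ∈ Set.univ.pi K, IsCompact (X ν x))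
    (hXne : ∀ ν, ∀ x ∈ Set.univ.pi K, (X ν x).Nonempty)
    (θ : N → JointSpace n → ℝ)
    (hθcont : ∀ ν, PseudoContinuous (θ ν))
    (hθconv : ∀ ν, ∀ x : JointSpace n,
      QuasiconvexOn ℝ Set.univ (fun z : Fin (n ν) → ℝ => θ ν (Function.update x ν z))) :
    ∃ x : JointSpace n, IsProjectedSolution nrm K X θ x := by
  have hPcomp : IsCompact (Set.univ.pi K) := isCompact_univ_pi hKcomp
  have hPconv : Convex ℝ (Set.univ.pi K) := convex_pi fun ν _ => hKconv ν
  have hPne : (Set.univ.pi K).Nonempty := Set.univ_pi_nonempty_iff.2 hKne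
  choose r hr using fun ν =>
    (hXcont ν).1.exists_subset_closedBall hPcomp fun x hx => (hXcomp ν x hx).isBounded
  set B : Set (JointSpace n) := Set.univ.pi fun ν => Metric.closedBall 0 (r ν) with hB
  have hBcomp : IsCompact B := isCompact_univ_pi fun ν => isCompact_closedBall _ _
  have hBconv : Convex ℝ B := convex_pi fun ν _ => convex_closedBall _ _
  set M : (ν : N) → JointSpace n × JointSpace n → Set (Fin (n ν) → ℝ) := fun ν p =>
    {z | z ∈ X ν p.1 ∧ ∀ w ∈ X ν p.1,
      θ ν (Function.update p.2 ν z) ≤ θ ν (Function.update p.2 ν w)} with hM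
  have hMne : ∀ ν, ∀ p, p.1 ∈ Set.univ.pi K → (M ν p).Nonempty := fun ν p hp =>
    (hXcomp ν p.1 hp).exists_forall_le_of_isOpen_lt (hXne ν p.1 hp) fun w =>
      (hθcont ν).isOpen_lt.preimage (f := fun z =>
        (Function.update p.2 ν w, Function.update p.2 ν z)) (by fun_prop)
  have hMconv : ∀ ν, ∀ p, p.1 ∈ Set.univ.pi K → Convex ℝ (M ν p) := by
    intro ν p hp u hu v hv a b ha hb hab
    refine ⟨hXconv ν p.1 hp hu.1 hv.1 ha hb hab, fun w hw => ?_⟩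
    -- `u` and `v` lie in the sublevel set at the value of the competitor `w`, which is convex.
    exact (hθconv ν p.2 _ ⟨Set.mem_univ _, hu.2 w hw⟩ ⟨Set.mem_univ _, hv.2 w hw⟩ ha hb hab).2
  have hMclosed : ∀ ν, IsClosed {q : (JointSpace n × JointSpace n) × (Fin (n ν) → ℝ) |
      q.1.1 ∈ Set.univ.pi K ∧ q.2 ∈ M ν q.1} := by
    intro ν
    have h1 := (hXcont ν).1.isClosed_graph hPcomp.isClosed (hXcomp ν)
    have h2 := (hXcont ν).2.isClosed_forall_notMem hPcomp.isClosed
      ((hθcont ν).isOpen_lt.preimage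
        (f := fun t : (JointSpace n × (Fin (n ν) → ℝ)) × (Fin (n ν) → ℝ) =>
          (Function.update t.1.1 ν t.2, Function.update t.1.1 ν t.1.2)) (by fun_prop))
    convert (h1.preimage (f := fun q : (JointSpace n × JointSpace n) × (Fin (n ν) → ℝ) =>
      (q.1.1, q.2)) (by fun_prop)).inter (h2.preimage
      (f := fun q : (JointSpace n × JointSpace n) × (Fin (n ν) → ℝ) =>
        (q.1.1, (q.1.2, q.2))) (by fun_prop)) using 1
    ext q
    simp only [hM, Set.mem_ofPred_eq, Set.mem_inter_iff, Set.mem_preimage, not_lt]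
    tauto
  obtain ⟨p, hpA, hp⟩ := exists_mem_of_isClosed_graph (A := Set.univ.pi K ×ˢ B)
    (F := fun p => projectionSet nrm (Set.univ.pi K) p.2 ×ˢ Set.univ.pi fun ν => M ν p)
    (hPcomp.prod hBcomp) (hPconv.prod hBconv)
    (by
      obtain ⟨x, hx⟩ := hPne
      choose y hy using fun ν => hXne ν x hx
      exact ⟨(x, y), hx, fun ν _ => hr ν x hx (hy ν)⟩)
    (fun p hp q hq => ⟨hq.1.1, fun ν hν => hr ν p.1 hp.1 (hq.2 ν hν).1⟩)
    (fun p hp => (projectionSet_nonempty nrm hPcomp hPne p.2).prod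
      (Set.univ_pi_nonempty_iff.2 fun ν => hMne ν p hp.1))
    (fun p hp => (convex_projectionSet nrm hPconv p.2).prod
      (convex_pi fun ν _ => hMconv ν p hp.1))
    (by
      have h1 := (hPcomp.prod hBcomp).isClosed.preimage
        (continuous_fst (X := JointSpace n × JointSpace n) (Y := JointSpace n × JointSpace n))
      have h2 := (isClosed_setOf_mem_projectionSet nrm hPcomp.isClosed).preimage
        (f := fun q : (JointSpace n × JointSpace n) × (JointSpace n × JointSpace n) =>
          (q.1.2, q.2.1)) (by fun_prop)
      have h3 := isClosed_iInter fun ν => (hMclosed ν).preimage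
        (f := fun q : (JointSpace n × JointSpace n) × (JointSpace n × JointSpace n) =>
          (q.1, q.2.2 ν)) (by fun_prop)
      convert (h1.inter h2).inter h3 using 1
      ext q
      simp only [Set.mem_ofPred_eq, Set.mem_inter_iff, Set.mem_preimage, Set.mem_iInter,
        Set.mem_prod, Set.mem_univ_pi]
      constructor
      · rintro ⟨hA, hP, hMq⟩
        exact ⟨⟨hA, hP⟩, fun ν => ⟨hA.1, hMq ν⟩⟩
      · rintro ⟨⟨hA, hP⟩, hMq⟩
        exact ⟨hA, hP, fun ν => (hMq ν).2⟩)
  have hpM : ∀ ν, p.2 ν ∈ M ν p := fun ν => hp.2 ν (Set.mem_univ ν)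
  refine ⟨p.1, hpA.1, p.2, fun ν _ => (hpM ν).1, hp.1, fun ν => ⟨(hpM ν).1, fun z hz => ?_⟩⟩
  simpa only [Function.update_eq_self] using (hpM ν).2 z hz
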